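/- Let $(\mathcal Z,g)$ be a smooth Riemannian manifold (finite-dimensional, Hausdorff, second countable, without boundary), $\Xi\subseteq\mathbb R^d$ open, $\phi\colon\Xi\to\mathcal Z$ smooth, and $\mathcal M=\phi(\Xi)$. A point $p\in\mathcal M$ is called non-singular if there is an open $U\ni p$ in $\mathcal Z$ such that $U\cap\mathcal M$ is an embedded submanifold of $\mathcal Z$; let $\mathrm{Smooth}(\mathcal M)$ be the set of non-singular points. For $\xi\in\Xi$ put $\partial_i(\xi)=d\phi_\xi(\partial/\partial\xi^i)$ and $G_{ij}(\xi)=g_{\phi(\xi)}(\partial_i(\xi),\partial_j(\xi))$. For $\xi\in\Xi$ with $\phi(\xi)\in\mathrm{Smooth}(\mathcal M)$, we say that $\phi$ is proper in $\xi$ if $\operatorname{span}\{\partial_1(\xi),\dots,\partial_d(\xi)\}=T_{\phi(\xi)}\mathcal M$. Suppose that $\mathrm{Smooth}(\mathcal M)$ is a manifold, that is, with the subspace topology it carries the structure of a smooth $n$-dimensional manifold for which the inclusion into $\mathcal Z$ is a smooth embedding. A subset $S\subseteq\mathrm{Smooth}(\mathcal M)$ has measure zero if $\psi(S\cap V)\subseteq\mathbb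 R^n$ is a Lebesgue null set for every smooth chart $(V,\psi)$ of $\mathrm{Smooth}(\mathcal M)$. Then: 1. The set $\{\phi(\xi) : \xi\in\Xi,\ \phi(\xi)\in\mathrm{Smooth}(\mathcal M),\ \phi\text{ is not proper in }\xi\}$ has measure zero in $\mathrm{Smooth}(\mathcal M)$. 2. Let $\mathcal L\colon\mathcal Z\to\mathbb R$ be smooth, and for each $\xi\in\Xi$ let $G^+(\xi)$ be any generalised inverse of $G(\xi)$, i.e. $G\,G^+G=G$. Let $\nabla_\xi\mathcal L$ be the vector of partial derivatives of $\mathcal L\circ\phi$ at $\xi$. Then the set of points $\phi(\xi)\in\mathrm{Smooth}(\mathcal M)$, $\xi\in\Xi$, at which the pushforward $d\phi_\xi\big(G^+(\xi)\nabla_\xi\mathcal L\big)$ of the natural parameter gradient differs from the natural gradient (the Riemannian gradient at $\phi(\xi)$ of $\mathcal L|_{\mathcal M}$ with respect to the metric induced by $g$) has measure zero in $\mathrm{Smooth}(\mathcal M)$. -/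

import Mathlib

open Set MeasureTheory
open scoped Manifold ContDiff Bundle

noncomputable section

namespace NatGrad

/-- `S`, with the subspace topology, carries a smooth structure of dimension `n` (without boundary)
for which the inclusion into `Z` is a smooth embedding. -/
def IsEmbeddedSubmanifold {m : ℕ} {Z : Type*} [TopologicalSpace Z]
    [ChartedSpace (EuclideanSpace ℝ (Fin m)) Z] (S : Set Z) (n : ℕ) : Prop :=
  ∃ (_ : ChartedSpace (EuclideanSpace ℝ (Fin n)) S) (_ : IsManifold (𝓡 n) ∞ S),
    Manifold.IsSmoothEmbedding (𝓡 n) (𝓡 m) ∞ (Subtype.val : S → Z)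

/-- The set of non-singular points of `M ⊆ Z`: the points of `M` around which `M` is locally an
embedded submanifold of `Z`. -/
def smoothPoints (m : ℕ) {Z : Type*} [TopologicalSpace Z]
    [ChartedSpace (EuclideanSpace ℝ (Fin m)) Z] (M : Set Z) : Set Z :=
  {p | p ∈ M ∧ ∃ U : Set Z, IsOpen U ∧ p ∈ U ∧
    ∃ n : ℕ, IsEmbeddedSubmanifold (m := m) (U ∩ M) n}

/-- The tangent space `T_p M ⊆ T_p Z`: the velocities at time `0` of the smooth curves of `Z` that
run inside `M` and pass through `p` at time `0`. At a non-singular point the velocities already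
form a linear subspace, so that taking the span adds nothing there. (`TangentSpace (𝓡 m) (γ 0)` and
`TangentSpace (𝓡 m) p` are the same type, and the identification along `γ 0 = p` is the identity.) -/
def tangentSpaceAt (m : ℕ) {Z : Type*} [TopologicalSpace Z]
    [ChartedSpace (EuclideanSpace ℝ (Fin m)) Z] (M : Set Z) (p : Z) :
    Submodule ℝ (TangentSpace (𝓡 m) p) :=
  Submodule.span ℝ {v : TangentSpace (𝓡 m) p | ∃ (γ : ℝ → Z) (ε : ℝ), 0 < ε ∧
    ContMDiffOn 𝓘(ℝ, ℝ) (𝓡 m) ∞ γ (Ioo (-ε) ε) ∧ MapsTo γ (Ioo (-ε) ε) M ∧ γ 0 = p ∧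
    (mfderiv 𝓘(ℝ, ℝ) (𝓡 m) γ 0 (1 : ℝ) : EuclideanSpace ℝ (Fin m)) = v}

/-- The coordinate vector `∂_i(ξ) = dφ_ξ(∂/∂ξ^i)`. -/
def coordVector (m : ℕ) {d : ℕ} {Z : Type*} [TopologicalSpace Z]
    [ChartedSpace (EuclideanSpace ℝ (Fin m)) Z] (φ : EuclideanSpace ℝ (Fin d) → Z)
    (ξ : EuclideanSpace ℝ (Fin d)) (i : Fin d) : TangentSpace (𝓡 m) (φ ξ) :=
  mfderiv (𝓡 d) (𝓡 m) φ ξ (EuclideanSpace.single i (1 : ℝ) : EuclideanSpace ℝ (Fin d))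

/-- `φ : Ξ → Z` is proper in `ξ`: the coordinate vectors at `ξ` span the tangent space of the model
`φ(Ξ)` at `φ(ξ)`. Only used for `φ(ξ)` non-singular. -/
def IsProperAt (m : ℕ) {d : ℕ} {Z : Type*} [TopologicalSpace Z]
    [ChartedSpace (EuclideanSpace ℝ (Fin m)) Z] (φ : EuclideanSpace ℝ (Fin d) → Z)
    (Ξ : Set (EuclideanSpace ℝ (Fin d))) (ξ : EuclideanSpace ℝ (Fin d)) : Prop :=
  Submodule.span ℝ (range (coordVector m φ ξ)) = tangentSpaceAt m (φ '' Ξ) (φ ξ)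

/-- `S` has measure zero in the smooth `n`-manifold `N`: its image in every smooth chart is a
Lebesgue null set of `ℝⁿ`. -/
def MeasureZero (n : ℕ) {N : Type*} [TopologicalSpace N]
    [ChartedSpace (EuclideanSpace ℝ (Fin n)) N] (S : Set N) : Prop :=
  ∀ e ∈ IsManifold.maximalAtlas (𝓡 n) ∞ N, volume (e '' (S ∩ e.source)) = 0

/-- The vector `∇_ξ L` of the partial derivatives of `L ∘ φ` at `ξ`. -/
def coordGradient {d : ℕ} {Z : Type*} (φ : EuclideanSpace ℝ (Fin d) → Z) (L : Z → ℝ)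
    (ξ : EuclideanSpace ℝ (Fin d)) : Fin d → ℝ :=
  fun i => fderiv ℝ (L ∘ φ) ξ (EuclideanSpace.single i (1 : ℝ))

/-- `B` is a generalised inverse of `A`. -/
def IsGeneralizedInverse {k l : ℕ} (A : Matrix (Fin k) (Fin l) ℝ) (B : Matrix (Fin l) (Fin k) ℝ) :
    Prop :=
  A * B * A = A

/-- The pushforward `dφ_ξ` of the natural parameter gradient `G⁺ ∇_ξ L`, where `Gp` is the
generalised inverse `G⁺` that is used at `ξ`. -/
def pushforwardNatParamGradient (m : ℕ) {d : ℕ} {Z : Type*} [TopologicalSpace Z]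
    [ChartedSpace (EuclideanSpace ℝ (Fin m)) Z] (φ : EuclideanSpace ℝ (Fin d) → Z) (L : Z → ℝ)
    (Gp : Matrix (Fin d) (Fin d) ℝ) (ξ : EuclideanSpace ℝ (Fin d)) : TangentSpace (𝓡 m) (φ ξ) :=
  mfderiv (𝓡 d) (𝓡 m) φ ξ
    (WithLp.toLp 2 (Gp.mulVec (coordGradient φ L ξ)) : EuclideanSpace ℝ (Fin d))

section Riemannian

variable {m d : ℕ} {Z : Type*} [TopologicalSpace Z] [ChartedSpace (EuclideanSpace ℝ (Fin m)) Z]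
  [Bundle.RiemannianBundle (fun x : Z => TangentSpace (𝓡 m) x)]

/-- The Gram matrix `G_ij(ξ) = g(∂_i(ξ), ∂_j(ξ))`. -/
def gramMatrix (φ : EuclideanSpace ℝ (Fin d) → Z) (ξ : EuclideanSpace ℝ (Fin d)) :
    Matrix (Fin d) (Fin d) ℝ :=
  Matrix.of fun i j => inner ℝ (coordVector m φ ξ i) (coordVector m φ ξ j)

instance tangentSpace_finiteDimensional (p : Z) :
    FiniteDimensional ℝ (TangentSpace (𝓡 m) p) :=
  inferInstanceAs (FiniteDimensional ℝ (EuclideanSpace ℝ (Fin m)))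

/-- The natural gradient at `p`, i.e. the Riemannian gradient at `p` of the restriction of `L` to
`M`: the Riesz representative in `T_p M` (with the inner product induced by `g`) of the restriction
of `dL_p` to `T_p M`. Only used for `p` non-singular. -/
def naturalGradient (M : Set Z) (L : Z → ℝ) (p : Z) : TangentSpace (𝓡 m) p :=
  ((InnerProductSpace.toDual ℝ (tangentSpaceAt m M p)).symm
    (LinearMap.toContinuousLinearMap
      ((mfderiv (𝓡 m) 𝓘(ℝ, ℝ) L p).toLinearMap ∘ₗ (tangentSpaceAt m M p).subtype)) :
    tangentSpaceAt m M p)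

end Riemannian

end NatGrad

end

/-!
In a chart `e` of the non-singular locus `S = Smooth (φ(Ξ))`, the parametrisation reads `j ∘ F`, where
`F = e ∘ φ` is a smooth map between Euclidean spaces and `j` is the inclusion of `S` read in `e`.
Smoothness of `F` is the universal property of the immersion `S → Z`. A velocity of a curve inside
`φ(Ξ)` through a point of `S` is likewise in the range of `dj`, because `S` is open in `φ(Ξ)`. Hence
`φ` is proper at every `ξ` where `dF` is surjective (`NatGrad.isProperAt_of_surjective`), and the
image of the non-proper points consists of critical values of `F`. These form a null set by Sard's
theorem (`Sard.addHaar_image_critical_eq_zero`).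

At a proper `ξ` the natural gradient `u` lies in the span of the coordinate vectors `∂ᵢ`, and
`∇_ξ L = G x` for any `x` with `u = ∑ xᵢ ∂ᵢ`. Since `G G⁺ G x = G x`, the vector
`∑ (G⁺ G x)ᵢ ∂ᵢ - u` of the span is orthogonal to every `∂ᵢ`, so it vanishes
(`NatGrad.sum_generalizedInverse_mulVec`). The exceptional set of the second claim is therefore
contained in that of the first.

Sard's theorem is proved for smooth maps between finite-dimensional spaces of arbitrary dimensions.

* For a real-valued `f` (`Sard.volume_image_critical_eq_zero`) the proof is by induction on the
  dimension `d` of the source. Where all derivatives of order `1, …, k` vanish and the next one does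
  not, some component of the `k`-th derivative cuts out a hypersurface containing the points
  considered, and the restriction of `f` to it is again critical there. Where all derivatives up to
  an order `k ≥ d` vanish, `f` is locally Hölder of exponent `k + 1 > d` on the set, so the image has
  Hausdorff dimension less than `1`.
* For a vector-valued map, the image of the set where the derivative is zero is null, because one
  nonzero functional already maps it to a null set.
* Near a point where the derivative has rank `r`, the implicit function theorem straightens `r`
  components: the map becomes `(t, y) ↦ (t, g (t, y))`, and rank `r` means `∂g/∂y = 0`. Each slice
  `t = const` of the image is null by the previous point, and Fubini's theorem concludes.
-/

namespace Sard

open Filter Topology Function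
open scoped NNReal ENNReal

/-! ### Local straightening of submersions -/

/-- The implicit function theorem as a straightening: near a point where `dw` is surjective there are
smooth coordinates whose first component is `w`. The inverse is smooth on the whole target, not only
at the image of the base point. -/
theorem exists_straightening {E H : Type*} [NormedAddCommGroup E] [NormedSpace ℝ E]
    [FiniteDimensional ℝ E] [NormedAddCommGroup H] [NormedSpace ℝ H] [FiniteDimensional ℝ H]
    {w : E → H} {W : Set E} (hW : IsOpen W) (hw : ∀ x ∈ W, ContDiffAt ℝ ∞ w x)
    {x₀ : E} (hx₀ : x₀ ∈ W) (hsurj : Surjective (fderiv ℝ w x₀)) :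
    ∃ Φ : OpenPartialHomeomorph E (H × (fderiv ℝ w x₀).ker),
      x₀ ∈ Φ.source ∧ Φ.source ⊆ W ∧ (∀ x, (Φ x).1 = w x) ∧
        ∀ z ∈ Φ.target, ContDiffAt ℝ ∞ Φ.symm z := by
  have : CompleteSpace E := FiniteDimensional.complete ℝ E
  have : CompleteSpace H := FiniteDimensional.complete ℝ H
  obtain ⟨P, hP⟩ := (Submodule.ClosedComplemented.of_finiteDimensional_quotient
    (fderiv ℝ w x₀).isClosed_ker : (fderiv ℝ w x₀).ker.ClosedComplemented)
  set T : E → H × (fderiv ℝ w x₀).ker := fun x => (w x, P x) with hT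
  have hTd : ∀ x ∈ W, HasFDerivAt T ((fderiv ℝ w x).prod P) x := fun x hx =>
    ((hw x hx).differentiableAt (by simp)).hasFDerivAt.prodMk P.hasFDerivAt
  have hTs : ∀ x ∈ W, ContDiffAt ℝ ∞ T x := fun x hx => (hw x hx).prodMk P.contDiff.contDiffAt
  have hinj : Injective ((fderiv ℝ w x₀).prod P) := by
    rw [injective_iff_map_eq_zero]
    intro v hv
    simp only [ContinuousLinearMap.prod_apply, Prod.mk_eq_zero] at hv
    exact congrArg Subtype.val ((hP ⟨v, hv.1⟩).symm.trans hv.2)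
  have hsur : Surjective ((fderiv ℝ w x₀).prod P) := by
    rintro ⟨h, k⟩
    obtain ⟨v, rfl⟩ := hsurj h
    refine ⟨v - (P v : E) + k, ?_⟩
    ext1
    · simp
    · simp [hP]
  let e₀ : E ≃L[ℝ] H × (fderiv ℝ w x₀).ker :=
    (LinearEquiv.ofBijective ((fderiv ℝ w x₀).prod P : E →ₗ[ℝ] _)
      ⟨hinj, hsur⟩).toContinuousLinearEquiv
  have he₀ : HasFDerivAt T (e₀ : E →L[ℝ] _) x₀ := (hTd x₀ hx₀).congr_fderiv (by ext1; rfl)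
  let Φ₀ := (hTs x₀ hx₀).toOpenPartialHomeomorph T he₀ (by simp)
  -- the inverse is smooth at the images of the points of `D`, to which the source is restricted
  let D : Set E := {x | x ∈ W ∧ (fderiv ℝ T x) ∈ range ((↑) : (E ≃L[ℝ] H × (fderiv ℝ w x₀).ker) → _)}
  have hD : IsOpen D := by
    rw [isOpen_iff_mem_nhds]
    rintro x ⟨hxW, hx⟩
    have hc : ContinuousAt (fderiv ℝ T) x :=
      ((hTs x hxW).fderiv_right (m := 0) (by simp)).continuousAt
    exact Filter.inter_mem (hW.mem_nhds hxW) (hc.preimage_mem_nhds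
      (ContinuousLinearEquiv.isOpen.mem_nhds hx))
  refine ⟨Φ₀.restrOpen D hD, ⟨?_, hx₀, e₀, he₀.fderiv.symm⟩, fun x hx => hx.2.1, fun x => rfl, ?_⟩
  · exact (hTs x₀ hx₀).mem_toOpenPartialHomeomorph_source he₀ (by simp)
  · intro z hz
    have hz' := (Φ₀.restrOpen D hD).map_target hz
    obtain ⟨hzW, e, he⟩ := hz'.2
    refine OpenPartialHomeomorph.contDiffAt_symm _ hz (f₀' := e) ?_ (hTs _ hzW)
    exact (((hTd _ hzW).differentiableAt).hasFDerivAt).congr_fderiv he.symm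

/-! ### Critical values of real-valued functions -/

theorem measure_image_eq_zero_of_locally {X Y : Type*} [TopologicalSpace X]
    [SecondCountableTopology X] [MeasurableSpace Y] (μ : Measure Y) {f : X → Y} {s : Set X}
    (h : ∀ x ∈ s, ∃ V ∈ 𝓝 x, μ (f '' (s ∩ V)) = 0) : μ (f '' s) = 0 := by
  have := measure_null_of_locally_null (μ := OuterMeasure.comap f μ.toOuterMeasure) s ?_
  · simpa using this
  · intro x hx
    obtain ⟨V, hV, h0⟩ := h x hx
    exact ⟨s ∩ V, inter_mem self_mem_nhdsWithin (mem_nhdsWithin_of_mem_nhds hV), by simpa using h0⟩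

section

variable {E : Type*} [NormedAddCommGroup E] [NormedSpace ℝ E]

/-- Taylor's inequality at a point where the derivatives of orders `1, …, k` vanish, by descending
induction on the order from the mean value inequality. -/
theorem norm_sub_le_of_iteratedFDeriv_eq_zero {f : E → ℝ} {s : Set E} (hs : Convex ℝ s)
    (hf : ∀ x ∈ s, ContDiffAt ℝ ∞ f x) {k : ℕ} {M : ℝ}
    (hM : ∀ z ∈ s, ‖iteratedFDeriv ℝ (k + 1) f z‖ ≤ M) {x : E} (hx : x ∈ s)
    (h0 : ∀ j, 1 ≤ j → j ≤ k → iteratedFDeriv ℝ j f x = 0) {y : E} (hy : y ∈ s) :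
    ‖f y - f x‖ ≤ M * ‖y - x‖ ^ (k + 1) := by
  have hM0 : 0 ≤ M := (norm_nonneg _).trans (hM x hx)
  have hd : ∀ j, ∀ z ∈ s, DifferentiableAt ℝ (iteratedFDeriv ℝ j f) z := fun j z hz =>
    ((hf z hz).iteratedFDeriv_right (m := 1) (i := j) (by exact_mod_cast le_top)).differentiableAt
      (by simp)
  have key : ∀ j i, i + j = k → ∀ y ∈ s,
      ‖iteratedFDeriv ℝ i f y - iteratedFDeriv ℝ i f x‖ ≤ M * ‖y - x‖ ^ (j + 1) := by
    intro j
    induction j with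
    | zero =>
      rintro i rfl y hy
      simpa using hs.norm_image_sub_le_of_norm_fderiv_le (hd i)
        (fun z hz => (norm_fderiv_iteratedFDeriv (𝕜 := ℝ) (f := f)).trans_le (hM z hz)) hx hy
    | succ j ih =>
      intro i hi y hy
      have hseg : segment ℝ x y ⊆ s := hs.segment_subset hx hy
      have := (convex_segment x y).norm_image_sub_le_of_norm_fderiv_le
        (f := iteratedFDeriv ℝ i f) (C := M * ‖y - x‖ ^ (j + 1)) (fun z hz => hd i z (hseg hz))
        (fun z hz => ?_) (left_mem_segment ℝ x y) (right_mem_segment ℝ x y)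
      · rwa [mul_assoc, ← pow_succ] at this
      · rw [norm_fderiv_iteratedFDeriv]
        have h1 := ih (i + 1) (by omega) z (hseg hz)
        rw [h0 (i + 1) (by omega) (by omega), sub_zero] at h1
        refine h1.trans ?_
        gcongr
        rw [← dist_eq_norm, ← dist_eq_norm, dist_comm z, dist_comm y]
        obtain ⟨t, ht, rfl⟩ := (segment_eq_image_lineMap ℝ x y ▸ hz :)
        rw [dist_left_lineMap, Real.norm_of_nonneg ht.1]
        exact mul_le_of_le_one_left dist_nonneg ht.2
  have h1 := key k 0 (by omega) y hy
  have h2 : iteratedFDeriv ℝ 0 f y - iteratedFDeriv ℝ 0 f x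
      = (continuousMultilinearCurryFin0 ℝ E ℝ).symm (f y - f x) := by
    ext; simp [iteratedFDeriv_zero_eq_comp]
  rwa [h2, LinearIsometryEquiv.norm_map] at h1

/-- A set of points that are critical to an order at least the dimension has a null image: the
function is locally Hölder on it, of an exponent exceeding the dimension. -/
theorem volume_image_eq_zero_of_flat [FiniteDimensional ℝ E] {f : E → ℝ} {W A : Set E}
    (hW : IsOpen W) (hf : ∀ x ∈ W, ContDiffAt ℝ ∞ f x) (hA : A ⊆ W) {k : ℕ}
    (hk : Module.finrank ℝ E ≤ k)
    (h0 : ∀ x ∈ A, ∀ j, 1 ≤ j → j ≤ k → iteratedFDeriv ℝ j f x = 0) :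
    volume (f '' A) = 0 := by
  have : ProperSpace E := FiniteDimensional.proper ℝ E
  have hdim : dimH (f '' A) ≤ dimH A / ((k + 1 : ℝ≥0) : ℝ≥0∞) := by
    refine dimH_image_le_of_locally_holder_on (by positivity) fun x₀ hx₀ => ?_
    have hc : ContinuousAt (fun z => ‖iteratedFDeriv ℝ (k + 1) f z‖) x₀ :=
      ((hf x₀ (hA hx₀)).iteratedFDeriv_right (m := 0) (i := k + 1)
        (by exact_mod_cast le_top)).continuousAt.norm
    have hev : ∀ᶠ z in 𝓝 x₀, z ∈ W ∧
        ‖iteratedFDeriv ℝ (k + 1) f z‖ < ‖iteratedFDeriv ℝ (k + 1) f x₀‖ + 1 :=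
      (hW.eventually_mem (hA hx₀)).and (hc.eventually_lt continuousAt_const (lt_add_one _))
    obtain ⟨ρ, hρ, hball⟩ := Metric.eventually_nhds_iff_ball.1 hev
    refine ⟨‖iteratedFDeriv ℝ (k + 1) f x₀‖₊ + 1, A ∩ Metric.ball x₀ ρ,
      inter_mem self_mem_nhdsWithin (mem_nhdsWithin_of_mem_nhds (Metric.ball_mem_nhds _ hρ)), ?_⟩
    rintro y ⟨hyA, hy⟩ x ⟨hxA, hx⟩
    have := norm_sub_le_of_iteratedFDeriv_eq_zero (convex_ball x₀ ρ) (fun z hz => hf z (hball z hz).1)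
      (fun z hz => (hball z hz).2.le) hy (h0 y hyA) hx
    rw [edist_comm, edist_comm y, edist_eq_enorm_sub, edist_eq_enorm_sub]
    have h3 : ((k + 1 : ℝ≥0) : ℝ) = ((k + 1 : ℕ) : ℝ) := by push_cast; rfl
    rw [h3, ENNReal.rpow_natCast]
    simp only [enorm_eq_nnnorm]
    rw [← ENNReal.coe_pow, ← ENNReal.coe_mul, ENNReal.coe_le_coe, ← NNReal.coe_le_coe]
    simpa using this
  have hlt : dimH (f '' A) < 1 := by
    refine hdim.trans_lt ?_
    rw [ENNReal.div_lt_iff (by simp) (by simp), one_mul]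
    refine (dimH_mono (subset_univ A)).trans_lt ?_
    rw [Real.dimH_univ_eq_finrank]
    exact_mod_cast Nat.lt_succ_of_le hk
  have := hausdorffMeasure_of_dimH_lt (d := 1) (by simpa using hlt)
  rw [← hausdorffMeasure_real]
  simpa using this

end

universe u

/-- The inductive step on the dimension: if critical points of `f` lie on the zero set of a function
`w` with nonzero differential, they are critical points of the restriction of `f` to that hypersurface. -/
theorem exists_nhds_volume_image_eq_zero {E : Type u} [NormedAddCommGroup E] [NormedSpace ℝ E]
    [FiniteDimensional ℝ E]
    (ih : ∀ (K : Type u) [NormedAddCommGroup K] [NormedSpace ℝ K] [FiniteDimensional ℝ K],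
      Module.finrank ℝ K < Module.finrank ℝ E → ∀ (g : K → ℝ) (O : Set K), IsOpen O →
        (∀ x ∈ O, ContDiffAt ℝ ∞ g x) → volume (g '' {x ∈ O | fderiv ℝ g x = 0}) = 0)
    {f w : E → ℝ} {W A : Set E} (hW : IsOpen W) (hf : ∀ x ∈ W, ContDiffAt ℝ ∞ f x)
    (hw : ∀ x ∈ W, ContDiffAt ℝ ∞ w x) (hfA : ∀ x ∈ A, fderiv ℝ f x = 0)
    (hwA : ∀ x ∈ A, w x = 0) {x₀ : E} (hx₀ : x₀ ∈ W) (hwx₀ : fderiv ℝ w x₀ ≠ 0) :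
    ∃ V ∈ 𝓝 x₀, volume (f '' (A ∩ V)) = 0 := by
  have hsurj : Surjective (fderiv ℝ w x₀) :=
    LinearMap.surjective (f := (fderiv ℝ w x₀ : E →ₗ[ℝ] ℝ)) fun h =>
      hwx₀ (ContinuousLinearMap.coe_injective h)
  obtain ⟨K, hKdef⟩ : ∃ K : Submodule ℝ E, K = (fderiv ℝ w x₀).ker := ⟨_, rfl⟩
  have hst := exists_straightening hW hw hx₀ hsurj
  rw [← hKdef] at hst
  obtain ⟨Φ, hΦx₀, hΦW, hΦw, hΦs⟩ := hst
  refine ⟨Φ.source, Φ.open_source.mem_nhds hΦx₀, ?_⟩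
  have hK : Module.finrank ℝ K < Module.finrank ℝ E := by
    refine Submodule.finrank_lt fun h => hwx₀ ?_
    ext v
    have : v ∈ (fderiv ℝ w x₀).ker := hKdef ▸ h ▸ Submodule.mem_top
    exact this
  have hψ : ∀ y : K, ((0 : ℝ), y) ∈ Φ.target →
      ContDiffAt ℝ ∞ (fun y : K => Φ.symm ((0 : ℝ), y)) y := fun y hy =>
    ContDiffAt.comp y (hΦs _ hy) (contDiffAt_const.prodMk contDiffAt_id)
  refine measure_mono_null ?_ (ih K hK (fun y => f (Φ.symm ((0 : ℝ), y)))
    {y | ((0 : ℝ), y) ∈ Φ.target} (Φ.open_target.preimage (by fun_prop)) fun y hy =>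
      ContDiffAt.comp y (hf _ (hΦW (Φ.map_target hy))) (hψ y hy))
  rintro _ ⟨x, ⟨hxA, hxΦ⟩, rfl⟩
  have hx : Φ x = ((0 : ℝ), (Φ x).2) := by
    ext1
    · simp [hΦw, hwA x hxA]
    · rfl
  have hxt : ((0 : ℝ), (Φ x).2) ∈ Φ.target := hx ▸ Φ.map_source hxΦ
  have hxi : Φ.symm ((0 : ℝ), (Φ x).2) = x := by rw [← hx, Φ.left_inv hxΦ]
  refine ⟨(Φ x).2, ⟨hxt, ?_⟩, by simp only [hxi]⟩
  have h1 := fderiv_comp (𝕜 := ℝ) (g := f) (f := fun y : K => Φ.symm ((0 : ℝ), y)) (Φ x).2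
    (by rw [hxi]; exact (hf x (hΦW hxΦ)).differentiableAt (by simp))
    ((hψ _ hxt).differentiableAt (by simp))
  rw [hxi, hfA x hxA, ContinuousLinearMap.zero_comp] at h1
  exact h1

theorem volume_image_critical_eq_zero_aux (d : ℕ) : ∀ (E : Type u) [NormedAddCommGroup E]
    [NormedSpace ℝ E] [FiniteDimensional ℝ E], Module.finrank ℝ E = d →
    ∀ (f : E → ℝ) (W : Set E), IsOpen W → (∀ x ∈ W, ContDiffAt ℝ ∞ f x) →
      volume (f '' {x ∈ W | fderiv ℝ f x = 0}) = 0 := by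
  induction d using Nat.strong_induction_on with
  | _ d IH =>
  intro E _ _ _ hd f W hW hf
  have : ProperSpace E := FiniteDimensional.proper ℝ E
  let A : ℕ → Set E := fun k => {x ∈ W | ∀ j, 1 ≤ j → j ≤ k → iteratedFDeriv ℝ j f x = 0}
  have hfd : ∀ x, iteratedFDeriv ℝ 1 f x = 0 ↔ fderiv ℝ f x = 0 := fun x => by
    rw [← norm_eq_zero, norm_iteratedFDeriv_one, norm_eq_zero]
  have hstep : ∀ k, volume (f '' (A (k + 1) \ A (k + 2))) = 0 := by
    intro k
    refine measure_image_eq_zero_of_locally _ fun x₀ hx₀ => ?_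
    have hne : fderiv ℝ (iteratedFDeriv ℝ (k + 1) f) x₀ ≠ 0 := by
      intro h
      refine hx₀.2 ⟨hx₀.1.1, fun j h1 hj => ?_⟩
      rcases Nat.lt_or_ge j (k + 2) with hlt | hge
      · exact hx₀.1.2 j h1 (by omega)
      · obtain rfl : j = k + 1 + 1 := by omega
        ext m
        rw [iteratedFDeriv_succ_apply_left, h]
        rfl
    obtain ⟨v, hv⟩ : ∃ v, fderiv ℝ (iteratedFDeriv ℝ (k + 1) f) x₀ v ≠ 0 := by
      by_contra! h
      exact hne (by ext1 v; exact h v)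
    -- a scalar component of the derivative of order `k + 1` with nonzero differential at `x₀`
    obtain ⟨l, -, hl⟩ := exists_dual_vector ℝ _ (norm_ne_zero_iff.2 hv)
    have hG : ∀ x ∈ W, ContDiffAt ℝ ∞ (iteratedFDeriv ℝ (k + 1) f) x := fun x hx =>
      (hf x hx).iteratedFDeriv_right (m := ∞) (by exact_mod_cast le_top)
    refine exists_nhds_volume_image_eq_zero (w := fun x => l (iteratedFDeriv ℝ (k + 1) f x))
      (fun K _ _ _ hK g O hO hg => IH _ (hd ▸ hK) K rfl g O hO hg) hW hf
      (fun x hx => l.contDiff.contDiffAt.comp x (hG x hx))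
      (fun x hx => (hfd x).1 (hx.1.2 1 le_rfl (by omega)))
      (fun x hx => by simp [hx.1.2 (k + 1) (by omega) le_rfl]) hx₀.1.1 fun h => ?_
    have h1 : HasFDerivAt (fun x => l (iteratedFDeriv ℝ (k + 1) f x))
        (l.comp (fderiv ℝ (iteratedFDeriv ℝ (k + 1) f) x₀)) x₀ :=
      l.hasFDerivAt.comp x₀ ((hG x₀ hx₀.1.1).differentiableAt (by simp)).hasFDerivAt
    rw [h1.fderiv] at h
    have h2 := congrArg (fun T : E →L[ℝ] ℝ => T v) h
    simp only [ContinuousLinearMap.comp_apply, hl, zero_apply] at h2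
    exact hv (norm_eq_zero.1 (by exact_mod_cast h2))
  have hall : ∀ k, volume (f '' (A 1 \ A (k + 1))) = 0 := by
    intro k
    induction k with
    | zero => simp
    | succ k ih =>
      refine measure_mono_null ?_ (measure_union_null ih (hstep k))
      rw [← image_union]
      refine image_mono fun x hx => ?_
      by_cases h : x ∈ A (k + 1)
      · exact Or.inr ⟨h, hx.2⟩
      · exact Or.inl ⟨hx.1, h⟩
  refine measure_mono_null ?_ (measure_union_null (hall d)
    (volume_image_eq_zero_of_flat hW hf (A := A (d + 1)) (fun x hx => hx.1)
      (k := d + 1) (by omega) fun x hx => hx.2))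
  rw [← image_union]
  refine image_mono fun x hx => ?_
  by_cases h : x ∈ A (d + 1)
  · exact Or.inr h
  · refine Or.inl ⟨⟨hx.1, fun j h1 h2 => ?_⟩, h⟩
    obtain rfl : j = 1 := by omega
    exact (hfd x).2 hx.2

/-- **Sard's theorem** for real-valued functions. -/
theorem volume_image_critical_eq_zero {E : Type*} [NormedAddCommGroup E]
    [NormedSpace ℝ E] [FiniteDimensional ℝ E] {f : E → ℝ} {W : Set E} (hW : IsOpen W)
    (hf : ∀ x ∈ W, ContDiffAt ℝ ∞ f x) : volume (f '' {x ∈ W | fderiv ℝ f x = 0}) = 0 :=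
  volume_image_critical_eq_zero_aux _ E rfl f W hW hf

/-! ### Critical values of vector-valued maps -/

theorem addHaar_preimage_eq_zero {E F : Type*} [NormedAddCommGroup E] [NormedSpace ℝ E]
    [FiniteDimensional ℝ E] [MeasurableSpace E] [BorelSpace E] [NormedAddCommGroup F]
    [NormedSpace ℝ F] [FiniteDimensional ℝ F] [MeasurableSpace F] [BorelSpace F]
    (μ : Measure E) [μ.IsAddHaarMeasure] (ν : Measure F) [ν.IsAddHaarMeasure]
    (L : E →ₗ[ℝ] F) (hL : Surjective L) {s : Set F} (hs : ν s = 0) : μ (L ⁻¹' s) = 0 := by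
  have : ProperSpace E := FiniteDimensional.proper ℝ E
  have : ProperSpace F := FiniteDimensional.proper ℝ F
  have h := (ae_comp_linearMap_mem_iff L μ ν hL (measurableSet_toMeasurable ν s).compl).2 (by
    rw [← measure_toMeasurable] at hs
    exact measure_eq_zero_iff_ae_notMem.1 hs)
  exact measure_mono_null (preimage_mono (subset_toMeasurable ν s))
    (measure_eq_zero_iff_ae_notMem.2 h)

/-- Composition with one nonzero linear functional reduces the claim to real-valued functions. -/
theorem addHaar_image_fderiv_eq_zero {K S : Type*} [NormedAddCommGroup K] [NormedSpace ℝ K]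
    [FiniteDimensional ℝ K] [NormedAddCommGroup S] [NormedSpace ℝ S] [FiniteDimensional ℝ S]
    [Nontrivial S] [MeasurableSpace S] [BorelSpace S] (μ : Measure S) [μ.IsAddHaarMeasure]
    {g : K → S} {O : Set K} (hO : IsOpen O) (hg : ∀ x ∈ O, ContDiffAt ℝ ∞ g x) :
    μ (g '' {x ∈ O | fderiv ℝ g x = 0}) = 0 := by
  obtain ⟨v, hv⟩ := exists_ne (0 : S)
  obtain ⟨l, -, hl⟩ := exists_dual_vector ℝ v (norm_ne_zero_iff.2 hv)
  have hl0 : (l : S →ₗ[ℝ] ℝ) ≠ 0 := fun h => by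
    have h1 : l v = 0 := congrArg (fun T : S →ₗ[ℝ] ℝ => T v) h
    rw [h1] at hl
    exact hv (norm_eq_zero.1 (by exact_mod_cast hl.symm))
  have h := volume_image_critical_eq_zero hO
    (fun x hx => l.contDiff.contDiffAt.comp x (hg x hx))
  refine measure_mono_null ?_ (addHaar_preimage_eq_zero μ volume (l : S →ₗ[ℝ] ℝ)
    (LinearMap.surjective hl0) h)
  rintro _ ⟨x, ⟨hxO, hx⟩, rfl⟩
  refine ⟨x, ⟨hxO, ?_⟩, rfl⟩
  have h1 : HasFDerivAt (l ∘ g) (l.comp (fderiv ℝ g x)) x :=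
    l.hasFDerivAt.comp x ((hg x hxO).differentiableAt (by simp)).hasFDerivAt
  rw [h1.fderiv, hx, ContinuousLinearMap.comp_zero]

/-- The Fubini step. Restricting to a compact set `N` makes the image compact, hence measurable. -/
theorem prod_image_partial_critical_eq_zero {R K S : Type*} [NormedAddCommGroup R]
    [NormedSpace ℝ R] [FiniteDimensional ℝ R] [MeasurableSpace R] [BorelSpace R]
    [NormedAddCommGroup K] [NormedSpace ℝ K] [FiniteDimensional ℝ K]
    [NormedAddCommGroup S] [NormedSpace ℝ S] [FiniteDimensional ℝ S]
    [Nontrivial S] [MeasurableSpace S] [BorelSpace S] (μ : Measure R)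
    (ν : Measure S) [ν.IsAddHaarMeasure]
    {g : R × K → S} {O N : Set (R × K)} (hO : IsOpen O) (hg : ∀ z ∈ O, ContDiffAt ℝ ∞ g z)
    (hN : IsCompact N) (hNO : N ⊆ O) :
    (μ.prod ν) ((fun z => (z.1, g z)) '' {z ∈ N | ∀ k, fderiv ℝ g z (0, k) = 0}) = 0 := by
  have : ProperSpace S := FiniteDimensional.proper ℝ S
  have : ProperSpace R := FiniteDimensional.proper ℝ R
  have hcompact : IsCompact {z ∈ N | ∀ k, fderiv ℝ g z (0, k) = 0} := by
    refine hN.of_isClosed_subset ?_ (sep_subset _ _)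
    have hc : ContinuousOn (fderiv ℝ g) N := fun z hz =>
      ((hg z (hNO hz)).fderiv_right (m := 0) (by simp)).continuousAt.continuousWithinAt
    have : {z ∈ N | ∀ k, fderiv ℝ g z (0, k) = 0}
        = N ∩ (fderiv ℝ g) ⁻¹' (⋂ k : K, {T | T (0, k) = 0}) := by
      ext z; simp
    rw [this]
    refine hc.preimage_isClosed_of_isClosed hN.isClosed (isClosed_iInter fun k => ?_)
    exact isClosed_eq (by fun_prop) continuous_const
  have hcont : ContinuousOn (fun z => (z.1, g z)) {z ∈ N | ∀ k, fderiv ℝ g z (0, k) = 0} :=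
    continuous_fst.continuousOn.prodMk fun z hz =>
      (hg z (hNO hz.1)).continuousAt.continuousWithinAt
  refine Measure.measure_prod_null_of_ae_null (hcompact.image_of_continuousOn hcont).measurableSet
    (Eventually.of_forall fun t => ?_)
  have hi : ∀ y : K, ContDiffAt ℝ ∞ (fun y : K => (t, y)) y := fun y =>
    contDiffAt_const.prodMk contDiffAt_id
  refine measure_mono_null ?_ (addHaar_image_fderiv_eq_zero ν (g := fun y => g (t, y))
    (O := {y | (t, y) ∈ O}) (hO.preimage (by fun_prop))
    fun y hy => ContDiffAt.comp y (hg _ hy) (hi y))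
  rintro s ⟨⟨t', y⟩, ⟨hz, hcrit⟩, hs⟩
  simp only [Prod.mk.injEq] at hs
  obtain ⟨rfl, rfl⟩ := hs
  refine ⟨y, ⟨hNO hz, ?_⟩, rfl⟩
  have h1 : HasFDerivAt (fun y => g (t', y))
      ((fderiv ℝ g (t', y)).comp (ContinuousLinearMap.inr ℝ R K)) y :=
    HasFDerivAt.comp y ((hg _ (hNO hz)).differentiableAt (by simp)).hasFDerivAt
      (hasFDerivAt_prodMk_right t' y)
  rw [h1.fderiv]
  ext1 k
  simpa using hcrit k

theorem eventually_surjective {X E F : Type*} [TopologicalSpace X] [NormedAddCommGroup E]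
    [NormedSpace ℝ E] [NormedAddCommGroup F] [NormedSpace ℝ F] [FiniteDimensional ℝ F]
    {T : X → E →L[ℝ] F} {x₀ : X} (hT : ContinuousAt T x₀) (hs : Surjective (T x₀)) :
    ∀ᶠ x in 𝓝 x₀, Surjective (T x) := by
  have : CompleteSpace F := FiniteDimensional.complete ℝ F
  obtain ⟨s, hs⟩ := (T x₀ : E →ₗ[ℝ] F).exists_rightInverse_of_surjective
    (LinearMap.range_eq_top.2 hs)
  let s' : F →L[ℝ] E := LinearMap.toContinuousLinearMap s
  have hc : ContinuousAt (fun x => (T x).comp s') x₀ := hT.clm_comp continuousAt_const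
  have h1 : (T x₀).comp s' = (ContinuousLinearEquiv.refl ℝ F : F →L[ℝ] F) := by
    ext v; exact congrArg (fun L : F →ₗ[ℝ] F => L v) hs
  have h2 : range ((↑) : (F ≃L[ℝ] F) → F →L[ℝ] F) ∈ 𝓝 ((T x₀).comp s') :=
    ContinuousLinearEquiv.isOpen.mem_nhds ⟨_, h1.symm⟩
  filter_upwards [hc.preimage_mem_nhds h2]
  rintro x ⟨e, he⟩ v
  obtain ⟨u, rfl⟩ := e.surjective v
  exact ⟨s' u, (congrArg (fun L : F →L[ℝ] F => L u) he).symm⟩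

/-- Where `f₁` is a submersion, points at which `df₂` vanishes on the kernel of `df₁` become, in
coordinates straightening `f₁`, points at which a partial derivative vanishes. -/
theorem exists_nhds_addHaar_image_eq_zero {E R S : Type*} [NormedAddCommGroup E]
    [NormedSpace ℝ E] [FiniteDimensional ℝ E] [NormedAddCommGroup R]
    [NormedSpace ℝ R] [FiniteDimensional ℝ R] [MeasurableSpace R] [BorelSpace R]
    [NormedAddCommGroup S] [NormedSpace ℝ S] [FiniteDimensional ℝ S]
    [Nontrivial S] [MeasurableSpace S] [BorelSpace S] (μ : Measure R)
    (ν : Measure S) [ν.IsAddHaarMeasure] {f₁ : E → R} {f₂ : E → S} {W : Set E} (hW : IsOpen W)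
    (hf₁ : ∀ x ∈ W, ContDiffAt ℝ ∞ f₁ x) (hf₂ : ∀ x ∈ W, ContDiffAt ℝ ∞ f₂ x)
    {x₀ : E} (hx₀ : x₀ ∈ W) (hsurj : Surjective (fderiv ℝ f₁ x₀)) :
    ∃ V ∈ 𝓝 x₀, (μ.prod ν) ((fun x => (f₁ x, f₂ x)) ''
      ({x ∈ W | (fderiv ℝ f₁ x).ker ≤ (fderiv ℝ f₂ x).ker} ∩ V)) = 0 := by
  obtain ⟨K, hKdef⟩ : ∃ K : Submodule ℝ E, K = (fderiv ℝ f₁ x₀).ker := ⟨_, rfl⟩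
  have hst := exists_straightening hW hf₁ hx₀ hsurj
  rw [← hKdef] at hst
  obtain ⟨Φ, hΦx₀, hΦW, hΦf, hΦs⟩ := hst
  have : ProperSpace (R × K) := FiniteDimensional.proper ℝ _
  obtain ⟨N, hN, hNt, hNx⟩ := local_compact_nhds
    (Φ.open_target.mem_nhds (Φ.map_source hΦx₀))
  refine ⟨Φ.source ∩ Φ ⁻¹' N, inter_mem (Φ.open_source.mem_nhds hΦx₀)
    ((Φ.continuousAt hΦx₀).preimage_mem_nhds hN), ?_⟩
  have hg : ∀ z ∈ Φ.target, ContDiffAt ℝ ∞ (f₂ ∘ Φ.symm) z := fun z hz =>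
    ContDiffAt.comp z (hf₂ _ (hΦW (Φ.map_target hz))) (hΦs z hz)
  refine measure_mono_null ?_ (prod_image_partial_critical_eq_zero μ ν Φ.open_target hg hNx hNt)
  rintro _ ⟨x, ⟨⟨hxW, hx⟩, hxΦ, hxN⟩, rfl⟩
  refine ⟨Φ x, ⟨hxN, fun k => ?_⟩, by simp [hΦf, Φ.left_inv hxΦ]⟩
  have ht := Φ.map_source hxΦ
  have hd := ((hΦs _ ht).differentiableAt (by simp)).hasFDerivAt
  have h2 : HasFDerivAt (f₂ ∘ Φ.symm) ((fderiv ℝ f₂ x).comp (fderiv ℝ Φ.symm (Φ x))) (Φ x) :=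
    HasFDerivAt.comp _ (by
      rw [Φ.left_inv hxΦ]; exact ((hf₂ x hxW).differentiableAt (by simp)).hasFDerivAt) hd
  have h1 : HasFDerivAt (f₁ ∘ Φ.symm) ((fderiv ℝ f₁ x).comp (fderiv ℝ Φ.symm (Φ x))) (Φ x) :=
    HasFDerivAt.comp _ (by
      rw [Φ.left_inv hxΦ]; exact ((hf₁ x hxW).differentiableAt (by simp)).hasFDerivAt) hd
  have h1' : HasFDerivAt (f₁ ∘ Φ.symm) (ContinuousLinearMap.fst ℝ R K) (Φ x) := by
    refine hasFDerivAt_fst.congr_of_eventuallyEq ?_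
    filter_upwards [Φ.open_target.mem_nhds ht] with z hz
    rw [comp_apply, ← hΦf, Φ.right_inv hz]
  rw [h2.fderiv]
  refine hx ?_
  have := congrArg (fun T : R × K →L[ℝ] R => T (0, k)) (h1.unique h1')
  simpa using this

/-- **Sard's theorem** for smooth maps between finite-dimensional real vector spaces: the set of
critical values is null. -/
theorem addHaar_image_critical_eq_zero {E F : Type*} [NormedAddCommGroup E] [NormedSpace ℝ E]
    [FiniteDimensional ℝ E] [NormedAddCommGroup F] [NormedSpace ℝ F] [FiniteDimensional ℝ F]
    [MeasurableSpace F] [BorelSpace F] (μ : Measure F) [μ.IsAddHaarMeasure] {f : E → F}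
    {W : Set E} (hW : IsOpen W) (hf : ∀ x ∈ W, ContDiffAt ℝ ∞ f x) :
    μ (f '' {x ∈ W | ¬ Surjective (fderiv ℝ f x)}) = 0 := by
  have : ProperSpace E := FiniteDimensional.proper ℝ E
  have : ProperSpace F := FiniteDimensional.proper ℝ F
  -- the critical points of rank `r`
  let C : ℕ → Set E := fun r =>
    {x ∈ W | ¬ Surjective (fderiv ℝ f x) ∧ Module.finrank ℝ (fderiv ℝ f x).range = r}
  suffices h : ∀ r, μ (f '' C r) = 0 by
    refine measure_mono_null ?_ (measure_iUnion_null h)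
    rw [← image_iUnion]
    exact image_mono fun x hx => mem_iUnion.2 ⟨_, hx.1, hx.2, rfl⟩
  intro r
  refine measure_image_eq_zero_of_locally μ fun x₀ hx₀ => ?_
  obtain ⟨hx₀W, hns, hr⟩ := hx₀
  obtain ⟨R, hR⟩ : ∃ R : Submodule ℝ F, R = (fderiv ℝ f x₀).range := ⟨_, rfl⟩
  rw [← hR] at hr
  obtain ⟨S, hS⟩ := R.exists_isCompl
  have hRtop : R ≠ ⊤ := fun h => hns (LinearMap.range_eq_top.1 (hR ▸ h))
  have hSnt : Nontrivial S := by
    rw [Submodule.nontrivial_iff_ne_bot]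
    rintro rfl
    exact hRtop (by simpa using hS.sup_eq_top)
  let e : F ≃L[ℝ] R × S := (Submodule.prodEquivOfIsCompl R S hS).symm.toContinuousLinearEquiv
  let p : F →L[ℝ] R := (ContinuousLinearMap.fst ℝ R S).comp (e : F →L[ℝ] R × S)
  let q : F →L[ℝ] S := (ContinuousLinearMap.snd ℝ R S).comp (e : F →L[ℝ] R × S)
  have hp : ∀ v : R, p v = v := fun v => by
    simp [p, e]
  have hpd : ∀ x ∈ W, fderiv ℝ (p ∘ f) x = p.comp (fderiv ℝ f x) := fun x hx =>
    (p.hasFDerivAt.comp x ((hf x hx).differentiableAt (by simp)).hasFDerivAt).fderiv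
  have hqd : ∀ x ∈ W, fderiv ℝ (q ∘ f) x = q.comp (fderiv ℝ f x) := fun x hx =>
    (q.hasFDerivAt.comp x ((hf x hx).differentiableAt (by simp)).hasFDerivAt).fderiv
  have hps : Surjective (fderiv ℝ (p ∘ f) x₀) := fun v => by
    obtain ⟨u, hu⟩ : (v : F) ∈ (fderiv ℝ f x₀).range := hR ▸ v.2
    refine ⟨u, ?_⟩
    rw [hpd x₀ hx₀W, ContinuousLinearMap.comp_apply]
    exact (congrArg p hu).trans (hp v)
  have hpc : ∀ x ∈ W, ContDiffAt ℝ ∞ (p ∘ f) x := fun x hx =>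
    p.contDiff.contDiffAt.comp x (hf x hx)
  have hev : ∀ᶠ x in 𝓝 x₀, Surjective (fderiv ℝ (p ∘ f) x) := by
    have hc : ContinuousAt (fderiv ℝ (p ∘ f)) x₀ :=
      ((hpc x₀ hx₀W).fderiv_right (m := 0) (by simp)).continuousAt
    exact eventually_surjective hc hps
  obtain ⟨V, hV, hV0⟩ := exists_nhds_addHaar_image_eq_zero (Measure.addHaar : Measure R)
    (Measure.addHaar : Measure S) hW hpc
    (fun x hx => q.contDiff.contDiffAt.comp x (hf x hx)) hx₀W hps
  refine ⟨V ∩ {x | Surjective (fderiv ℝ (p ∘ f) x)}, inter_mem hV hev, ?_⟩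
  refine measure_mono_null ?_ (addHaar_preimage_eq_zero μ _ (e : F →ₗ[ℝ] R × S) e.surjective hV0)
  rintro _ ⟨x, ⟨⟨hxW, -, hxr⟩, hxV, hxs⟩, rfl⟩
  refine ⟨x, ⟨⟨hxW, fun v hv => ?_⟩, hxV⟩, rfl⟩
  -- `p` maps the range of `fderiv ℝ f x` onto `R`, which has the same dimension `r`
  have hinj : Injective ((p : F →ₗ[ℝ] R).domRestrict (fderiv ℝ f x).range) := by
    rw [LinearMap.injective_iff_surjective_of_finrank_eq_finrank (hxr.trans hr.symm)]
    intro t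
    obtain ⟨u, hu⟩ := hxs t
    rw [hpd x hxW] at hu
    exact ⟨⟨fderiv ℝ f x u, u, rfl⟩, hu⟩
  have hv0 : fderiv ℝ f x v = 0 := by
    have h1 : (p : F →ₗ[ℝ] R).domRestrict (fderiv ℝ f x).range ⟨fderiv ℝ f x v, v, rfl⟩ = 0 := by
      have h2 : fderiv ℝ (p ∘ f) x v = 0 := hv
      rw [hpd x hxW] at h2
      exact h2
    exact congrArg Subtype.val (hinj (h1.trans (map_zero _).symm))
  have : fderiv ℝ (q ∘ f) x v = 0 := by
    rw [hqd x hxW, ContinuousLinearMap.comp_apply, hv0, map_zero]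
  exact this

end Sard

namespace NatGrad

open Filter Topology Function

/-! ### Maps into an embedded submanifold -/

section Lift

variable {m n : ℕ} {Z : Type*} [TopologicalSpace Z] [ChartedSpace (EuclideanSpace ℝ (Fin m)) Z]
  {S : Set Z} [ChartedSpace (EuclideanSpace ℝ (Fin n)) S]
  {E : Type*} [NormedAddCommGroup E] [NormedSpace ℝ E]

/-- A smooth map into `Z` that takes values in an embedded submanifold `S` is smooth as a map to `S`.
The corestriction is expressed through a retraction `c` of sets, which need not be continuous. -/
theorem contMDiffAt_lift
    (hS : Manifold.IsSmoothEmbedding (𝓡 n) (𝓡 m) ∞ (Subtype.val : S → Z))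
    {c : Z → S} (hc : ∀ q : S, c q = q) {f : E → Z} {x : E}
    (hf : ContMDiffAt 𝓘(ℝ, E) (𝓡 m) ∞ f x) (hfS : ∀ᶠ y in 𝓝 x, f y ∈ S) :
    ContMDiffAt 𝓘(ℝ, E) (𝓡 n) ∞ (c ∘ f) x := by
  have heq : (Subtype.val : S → Z) ∘ (c ∘ f) =ᶠ[𝓝 x] f := by
    filter_upwards [hfS] with y hy
    exact congrArg Subtype.val (hc ⟨f y, hy⟩)
  refine (ContMDiffAt.iff_comp_isImmersionAt (hS.isImmersion.isImmersionAt _)).2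
    ⟨hS.isEmbedding.isInducing.continuousAt_iff.2 ?_, hf.congr_of_eventuallyEq heq⟩
  exact hf.continuousAt.congr heq.symm

theorem contMDiffAt_chart_lift [IsManifold (𝓡 n) ∞ S]
    (hS : Manifold.IsSmoothEmbedding (𝓡 n) (𝓡 m) ∞ (Subtype.val : S → Z))
    {c : Z → S} (hc : ∀ q : S, c q = q) {f : E → Z} {x : E}
    (hf : ContMDiffAt 𝓘(ℝ, E) (𝓡 m) ∞ f x) (hfS : ∀ᶠ y in 𝓝 x, f y ∈ S)
    {e : OpenPartialHomeomorph S (EuclideanSpace ℝ (Fin n))}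
    (he : e ∈ IsManifold.maximalAtlas (𝓡 n) ∞ S) (hx : c (f x) ∈ e.source) :
    ContMDiffAt 𝓘(ℝ, E) (𝓡 n) ∞ (e ∘ c ∘ f) x :=
  ContMDiffAt.comp x ((contMDiffOn_of_mem_maximalAtlas he).contMDiffAt (e.open_source.mem_nhds hx))
    (contMDiffAt_lift hS hc hf hfS)

/-- A smooth map that takes values in `S` has its derivative factor through the derivative of the
inclusion read in the chart `e`. -/
theorem mfderiv_eq_comp_chart_lift [IsManifold (𝓡 n) ∞ S]
    (hS : Manifold.IsSmoothEmbedding (𝓡 n) (𝓡 m) ∞ (Subtype.val : S → Z))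
    {c : Z → S} (hc : ∀ q : S, c q = q) {f : E → Z} {x : E}
    (hf : ContMDiffAt 𝓘(ℝ, E) (𝓡 m) ∞ f x) (hfS : ∀ᶠ y in 𝓝 x, f y ∈ S)
    {e : OpenPartialHomeomorph S (EuclideanSpace ℝ (Fin n))}
    (he : e ∈ IsManifold.maximalAtlas (𝓡 n) ∞ S) (hx : c (f x) ∈ e.source) :
    (mfderiv 𝓘(ℝ, E) (𝓡 m) f x : E →L[ℝ] EuclideanSpace ℝ (Fin m)) =
      (mfderiv (𝓡 n) (𝓡 m) (Subtype.val ∘ e.symm) (e (c (f x))) :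
        EuclideanSpace ℝ (Fin n) →L[ℝ] EuclideanSpace ℝ (Fin m)).comp
      (mfderiv 𝓘(ℝ, E) (𝓡 n) (e ∘ c ∘ f) x : E →L[ℝ] EuclideanSpace ℝ (Fin n)) := by
  have h1 : ContMDiffAt (𝓡 n) (𝓡 m) ∞ (Subtype.val ∘ e.symm) ((e ∘ c ∘ f) x) :=
    ContMDiffAt.comp _ (hS.contMDiff _) ((contMDiffOn_symm_of_mem_maximalAtlas he).contMDiffAt
      (e.open_target.mem_nhds (e.map_source hx)))
  have h2 := contMDiffAt_chart_lift hS hc hf hfS he hx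
  have heq : f =ᶠ[𝓝 x] (Subtype.val ∘ e.symm) ∘ (e ∘ c ∘ f) := by
    filter_upwards [hfS, (contMDiffAt_lift hS hc hf hfS).continuousAt.preimage_mem_nhds
      (e.open_source.mem_nhds hx)] with y hy hye
    simp only [comp_apply]
    rw [show e.symm (e (c (f y))) = c (f y) from e.left_inv hye]
    exact (congrArg Subtype.val (hc ⟨f y, hy⟩)).symm
  have h3 := ((h1.mdifferentiableAt (by simp)).hasMFDerivAt.comp x
    (h2.mdifferentiableAt (by simp)).hasMFDerivAt).congr_of_eventuallyEq heq
  exact h3.mfderiv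

end Lift

/-! ### Proper points of the parametrisation -/

section Proper

variable {m d : ℕ} {Z : Type*} [TopologicalSpace Z] [ChartedSpace (EuclideanSpace ℝ (Fin m)) Z]

/-- The non-singular points of `M` form an open subset of `M`. -/
theorem eventually_mem_smoothPoints {M : Set Z} {p : Z} (hp : p ∈ smoothPoints m M) :
    ∀ᶠ z in 𝓝 p, z ∈ M → z ∈ smoothPoints m M := by
  obtain ⟨-, U, hU, hpU, hn⟩ := hp
  filter_upwards [hU.mem_nhds hpU] with z hz hzM
  exact ⟨hzM, U, hU, hz, hn⟩

theorem mfderiv_toLp (φ : EuclideanSpace ℝ (Fin d) → Z) (ξ : EuclideanSpace ℝ (Fin d))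
    (x : EuclideanSpace ℝ (Fin d)) :
    mfderiv (𝓡 d) (𝓡 m) φ ξ x = ∑ i, x i • coordVector m φ ξ i := by
  have h : x = ∑ i, x i • (EuclideanSpace.single i (1 : ℝ) : EuclideanSpace ℝ (Fin d)) := by
    ext j
    simp [Pi.single_apply]
  conv_lhs => rw [h]
  unfold coordVector
  exact (map_sum _ _ _).trans (Finset.sum_congr rfl fun i _ => map_smul _ _ _)

theorem mem_span_coordVector {φ : EuclideanSpace ℝ (Fin d) → Z} {ξ : EuclideanSpace ℝ (Fin d)}
    {v : TangentSpace (𝓡 m) (φ ξ)} :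
    v ∈ Submodule.span ℝ (range (coordVector m φ ξ)) ↔
      ∃ x : EuclideanSpace ℝ (Fin d), mfderiv (𝓡 d) (𝓡 m) φ ξ x = v := by
  rw [Submodule.mem_span_range_iff_exists_fun]
  constructor
  · rintro ⟨c, rfl⟩
    exact ⟨WithLp.toLp 2 c, mfderiv_toLp φ ξ _⟩
  · rintro ⟨x, rfl⟩
    exact ⟨x, (mfderiv_toLp φ ξ x).symm⟩

/-- Images of vectors under `dφ_ξ` are tangent to the model: they are velocities of images of line
segments. -/
theorem mfderiv_mem_tangentSpaceAt {Ξ : Set (EuclideanSpace ℝ (Fin d))}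
    (hΞ : IsOpen Ξ) {φ : EuclideanSpace ℝ (Fin d) → Z} (hφ : ContMDiffOn (𝓡 d) (𝓡 m) ∞ φ Ξ)
    {ξ : EuclideanSpace ℝ (Fin d)} (hξ : ξ ∈ Ξ) (v : EuclideanSpace ℝ (Fin d)) :
    mfderiv (𝓡 d) (𝓡 m) φ ξ v ∈ tangentSpaceAt m (φ '' Ξ) (φ ξ) := by
  have hline : ContDiff ℝ ∞ (fun t : ℝ => ξ + t • v) := by fun_prop
  have hl0 : ξ + (0 : ℝ) • v = ξ := by simp
  obtain ⟨ε, hε, hball⟩ := Metric.eventually_nhds_iff_ball.1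
    (hline.continuous.continuousAt.eventually_mem (x := (0 : ℝ))
      (hΞ.mem_nhds (hl0.symm ▸ hξ)))
  rw [Real.ball_eq_Ioo, zero_sub, zero_add] at hball
  refine Submodule.subset_span ⟨fun t => φ (ξ + t • v), ε, hε, ?_, ?_, by simp, ?_⟩
  · exact hφ.comp hline.contMDiff.contMDiffOn hball
  · exact fun t ht => ⟨_, hball t ht, rfl⟩
  · have h1 : HasMFDerivAt 𝓘(ℝ, ℝ) (𝓡 d) (fun t : ℝ => ξ + t • v) 0
        (ContinuousLinearMap.smulRight (1 : ℝ →L[ℝ] ℝ) v) := by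
      have := ((hasDerivAt_id (0 : ℝ)).smul_const v).const_add ξ
      simp only [id, one_smul] at this
      exact this.hasFDerivAt.hasMFDerivAt
    have h2 : HasMFDerivAt (𝓡 d) (𝓡 m) φ (ξ + (0 : ℝ) • v) (mfderiv (𝓡 d) (𝓡 m) φ ξ) := by
      rw [hl0]
      exact ((hφ.contMDiffAt (hΞ.mem_nhds hξ)).mdifferentiableAt (by simp)).hasMFDerivAt
    have h3 := (h2.comp (0 : ℝ) h1).mfderiv
    have h4 := congrArg (fun T : ℝ →L[ℝ] EuclideanSpace ℝ (Fin m) => T 1) h3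
    refine h4.trans ?_
    change (mfderiv (𝓡 d) (𝓡 m) φ ξ : EuclideanSpace ℝ (Fin d) →L[ℝ] EuclideanSpace ℝ (Fin m))
      ((1 : ℝ) • v) = _
    rw [one_smul]

/-- `φ` is proper at every regular point of its coordinate expression `e ∘ φ` in a chart of the
non-singular locus. -/
theorem isProperAt_of_surjective {n : ℕ}
    {Ξ : Set (EuclideanSpace ℝ (Fin d))} (hΞ : IsOpen Ξ) {φ : EuclideanSpace ℝ (Fin d) → Z}
    (hφ : ContMDiffOn (𝓡 d) (𝓡 m) ∞ φ Ξ)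
    [ChartedSpace (EuclideanSpace ℝ (Fin n)) (smoothPoints m (φ '' Ξ))]
    [IsManifold (𝓡 n) ∞ (smoothPoints m (φ '' Ξ))]
    (hS : Manifold.IsSmoothEmbedding (𝓡 n) (𝓡 m) ∞
      (Subtype.val : smoothPoints m (φ '' Ξ) → Z))
    {c : Z → smoothPoints m (φ '' Ξ)} (hc : ∀ q : smoothPoints m (φ '' Ξ), c q = q)
    {e : OpenPartialHomeomorph (smoothPoints m (φ '' Ξ)) (EuclideanSpace ℝ (Fin n))}
    (he : e ∈ IsManifold.maximalAtlas (𝓡 n) ∞ (smoothPoints m (φ '' Ξ)))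
    {ξ : EuclideanSpace ℝ (Fin d)} (hξ : ξ ∈ Ξ) (hξS : φ ξ ∈ smoothPoints m (φ '' Ξ))
    (hξe : c (φ ξ) ∈ e.source) (hsurj : Surjective (fderiv ℝ (e ∘ c ∘ φ) ξ)) :
    IsProperAt m φ Ξ ξ := by
  have hφξ : ContMDiffAt (𝓡 d) (𝓡 m) ∞ φ ξ := hφ.contMDiffAt (hΞ.mem_nhds hξ)
  refine le_antisymm (fun v hv => ?_) (Submodule.span_le.2 ?_)
  · obtain ⟨x, rfl⟩ := mem_span_coordVector.1 hv
    exact mfderiv_mem_tangentSpaceAt hΞ hφ hξ x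
  · rintro v ⟨γ, ε, hε, hγ, hγM, hγ0, hv⟩
    refine mem_span_coordVector.2 ?_
    have hI : Ioo (-ε) ε ∈ 𝓝 (0 : ℝ) := Ioo_mem_nhds (by linarith) hε
    have hγs : ContMDiffAt 𝓘(ℝ, ℝ) (𝓡 m) ∞ γ 0 := hγ.contMDiffAt hI
    have hγS : ∀ᶠ t in 𝓝 (0 : ℝ), γ t ∈ smoothPoints m (φ '' Ξ) := by
      filter_upwards [hI, hγs.continuousAt.eventually
        (eventually_mem_smoothPoints (hγ0.symm ▸ hξS))] with t ht ht'
      exact ht' (hγM ht)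
    have hφS : ∀ᶠ η in 𝓝 ξ, φ η ∈ smoothPoints m (φ '' Ξ) := by
      filter_upwards [hΞ.mem_nhds hξ, hφξ.continuousAt.eventually
        (eventually_mem_smoothPoints hξS)] with η hη hη'
      exact hη' ⟨η, hη, rfl⟩
    have h1 := mfderiv_eq_comp_chart_lift hS hc hγs hγS he (hγ0.symm ▸ hξe)
    have h2 := mfderiv_eq_comp_chart_lift hS hc hφξ hφS he hξe
    rw [hγ0] at h1
    obtain ⟨x, hx⟩ := hsurj
      ((mfderiv 𝓘(ℝ, ℝ) (𝓡 n) (e ∘ c ∘ γ) 0 : ℝ →L[ℝ] EuclideanSpace ℝ (Fin n)) 1)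
    refine ⟨x, ?_⟩
    rw [← mfderiv_eq_fderiv] at hx
    have h1' := congrArg (fun T : ℝ →L[ℝ] EuclideanSpace ℝ (Fin m) => T 1) h1
    have h2' := congrArg
      (fun T : EuclideanSpace ℝ (Fin d) →L[ℝ] EuclideanSpace ℝ (Fin m) => T x) h2
    have hx' := congrArg (mfderiv (𝓡 n) (𝓡 m) (Subtype.val ∘ e.symm) (e (c (φ ξ))) :
      EuclideanSpace ℝ (Fin n) →L[ℝ] EuclideanSpace ℝ (Fin m)) hx
    exact h2'.trans (hx'.trans (h1'.symm.trans hv))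

theorem measureZero_not_isProperAt {n : ℕ}
    {Ξ : Set (EuclideanSpace ℝ (Fin d))} (hΞ : IsOpen Ξ) {φ : EuclideanSpace ℝ (Fin d) → Z}
    (hφ : ContMDiffOn (𝓡 d) (𝓡 m) ∞ φ Ξ)
    [ChartedSpace (EuclideanSpace ℝ (Fin n)) (smoothPoints m (φ '' Ξ))]
    [IsManifold (𝓡 n) ∞ (smoothPoints m (φ '' Ξ))]
    (hS : Manifold.IsSmoothEmbedding (𝓡 n) (𝓡 m) ∞
      (Subtype.val : smoothPoints m (φ '' Ξ) → Z)) :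
    MeasureZero n {q : smoothPoints m (φ '' Ξ) | ∃ ξ ∈ Ξ, φ ξ = q ∧ ¬ IsProperAt m φ Ξ ξ} := by
  intro e he
  rcases isEmpty_or_nonempty (smoothPoints m (φ '' Ξ)) with hemp | hne
  · rw [eq_empty_of_isEmpty ({q : smoothPoints m (φ '' Ξ) | _} ∩ e.source), image_empty,
      measure_empty]
  let c : Z → smoothPoints m (φ '' Ξ) := invFun Subtype.val
  have hc : ∀ q : smoothPoints m (φ '' Ξ), c q = q := leftInverse_invFun Subtype.val_injective
  let W : Set (EuclideanSpace ℝ (Fin d)) :=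
    {ξ | ξ ∈ Ξ ∧ φ ξ ∈ smoothPoints m (φ '' Ξ) ∧ c (φ ξ) ∈ e.source}
  have hφξ : ∀ ξ ∈ Ξ, ContMDiffAt (𝓡 d) (𝓡 m) ∞ φ ξ := fun ξ hξ =>
    hφ.contMDiffAt (hΞ.mem_nhds hξ)
  have hφS : ∀ ξ ∈ W, ∀ᶠ η in 𝓝 ξ, φ η ∈ smoothPoints m (φ '' Ξ) := fun ξ hξ => by
    filter_upwards [hΞ.mem_nhds hξ.1, (hφξ ξ hξ.1).continuousAt.eventually
      (eventually_mem_smoothPoints hξ.2.1)] with η hη hη'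
    exact hη' ⟨η, hη, rfl⟩
  have hW : IsOpen W := by
    rw [isOpen_iff_mem_nhds]
    intro ξ hξ
    filter_upwards [hΞ.mem_nhds hξ.1, hφS ξ hξ,
      (contMDiffAt_lift hS hc (hφξ ξ hξ.1) (hφS ξ hξ)).continuousAt.preimage_mem_nhds
        (e.open_source.mem_nhds hξ.2.2)] with η h1 h2 h3
    exact ⟨h1, h2, h3⟩
  have hF : ∀ ξ ∈ W, ContDiffAt ℝ ∞ (e ∘ c ∘ φ) ξ := fun ξ hξ =>
    (contMDiffAt_chart_lift hS hc (hφξ ξ hξ.1) (hφS ξ hξ) he hξ.2.2).contDiffAt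
  refine measure_mono_null ?_ (Sard.addHaar_image_critical_eq_zero volume hW hF)
  rintro _ ⟨q, ⟨⟨ξ, hξ, hξq, hnp⟩, hqe⟩, rfl⟩
  have hq : c (φ ξ) = q := by rw [hξq, hc]
  have hξW : ξ ∈ W := ⟨hξ, hξq ▸ q.2, hq ▸ hqe⟩
  refine ⟨ξ, ⟨hξW, fun hs => hnp ?_⟩, by simp [hq]⟩
  exact isProperAt_of_surjective hΞ hφ hS hc he hξ hξW.2.1 hξW.2.2 hs

end Proper

/-! ### The natural gradient at a proper point -/

section Gradient

/-- A generalised inverse of the Gram matrix of a family recovers a vector of its span from the inner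
products with the family. -/
theorem sum_generalizedInverse_mulVec {d : ℕ} {V : Type*} [NormedAddCommGroup V]
    [InnerProductSpace ℝ V] (b : Fin d → V) {u : V} (hu : u ∈ Submodule.span ℝ (range b))
    {B : Matrix (Fin d) (Fin d) ℝ}
    (hB : IsGeneralizedInverse (Matrix.of fun i j => inner ℝ (b i) (b j)) B) :
    ∑ i, (B.mulVec fun i => inner ℝ (b i) u) i • b i = u := by
  set G : Matrix (Fin d) (Fin d) ℝ := Matrix.of fun i j => inner ℝ (b i) (b j) with hG
  have hmul : ∀ x : Fin d → ℝ, G.mulVec x = fun i => inner ℝ (b i) (∑ j, x j • b j) := fun x => by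
    ext i
    simp [hG, Matrix.mulVec, dotProduct, inner_sum, real_inner_smul_right, mul_comm]
  obtain ⟨x, rfl⟩ := (Submodule.mem_span_range_iff_exists_fun ℝ).1 hu
  rw [← hmul]
  set y := B.mulVec (G.mulVec x) with hy
  have hGy : G.mulVec y = G.mulVec x := by
    rw [hy, Matrix.mulVec_mulVec, Matrix.mulVec_mulVec, hB]
  have horth : ∀ i, inner ℝ (b i) (∑ j, y j • b j - ∑ j, x j • b j) = 0 := fun i => by
    rw [inner_sub_right, sub_eq_zero]
    rw [hmul, hmul] at hGy
    exact congrFun hGy i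
  rw [← sub_eq_zero, ← inner_self_eq_zero (𝕜 := ℝ)]
  conv_lhs => rw [← Finset.sum_sub_distrib]
  rw [sum_inner]
  refine Finset.sum_eq_zero fun i _ => ?_
  rw [← sub_smul, real_inner_smul_left, Finset.sum_sub_distrib, horth, mul_zero]

variable {m d : ℕ} {Z : Type*} [TopologicalSpace Z] [ChartedSpace (EuclideanSpace ℝ (Fin m)) Z]
  [Bundle.RiemannianBundle (fun x : Z => TangentSpace (𝓡 m) x)]

theorem pushforward_eq_naturalGradient {Ξ : Set (EuclideanSpace ℝ (Fin d))}
    {φ : EuclideanSpace ℝ (Fin d) → Z} {ξ : EuclideanSpace ℝ (Fin d)}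
    (hφ : MDifferentiableAt (𝓡 d) (𝓡 m) φ ξ) (hp : IsProperAt m φ Ξ ξ) {L : Z → ℝ}
    (hL : MDifferentiableAt (𝓡 m) 𝓘(ℝ, ℝ) L (φ ξ)) {B : Matrix (Fin d) (Fin d) ℝ}
    (hB : IsGeneralizedInverse (gramMatrix (m := m) φ ξ) B) :
    pushforwardNatParamGradient m φ L B ξ = naturalGradient (φ '' Ξ) L (φ ξ) := by
  have hu : naturalGradient (φ '' Ξ) L (φ ξ) ∈ Submodule.span ℝ (range (coordVector m φ ξ)) := by
    rw [hp]
    exact Subtype.prop _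
  have hgrad : coordGradient φ L ξ
      = fun i => inner ℝ (coordVector m φ ξ i) (naturalGradient (φ '' Ξ) L (φ ξ)) := by
    ext i
    have hmem : coordVector m φ ξ i ∈ tangentSpaceAt m (φ '' Ξ) (φ ξ) :=
      hp ▸ Submodule.subset_span ⟨i, rfl⟩
    have h1 : inner ℝ (naturalGradient (φ '' Ξ) L (φ ξ)) (coordVector m φ ξ i)
        = mfderiv (𝓡 m) 𝓘(ℝ, ℝ) L (φ ξ) (coordVector m φ ξ i) :=
      InnerProductSpace.toDual_symm_apply (𝕜 := ℝ) (E := tangentSpaceAt m (φ '' Ξ) (φ ξ))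
        (x := ⟨coordVector m φ ξ i, hmem⟩)
    rw [real_inner_comm, h1]
    have h2 := mfderiv_comp (I' := 𝓡 m) (I'' := 𝓘(ℝ, ℝ)) ξ hL hφ
    rw [mfderiv_eq_fderiv] at h2
    unfold coordGradient
    rw [h2]
    rfl
  unfold pushforwardNatParamGradient
  rw [mfderiv_toLp, hgrad]
  exact sum_generalizedInverse_mulVec (coordVector m φ ξ) hu hB

end Gradient

end NatGrad

theorem proposition1 {m d n : ℕ}
    {Z : Type*} [TopologicalSpace Z] [T2Space Z] [SecondCountableTopology Z]
    [ChartedSpace (EuclideanSpace ℝ (Fin m)) Z] [IsManifold (𝓡 m) ∞ Z]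
    [Bundle.RiemannianBundle (fun x : Z => TangentSpace (𝓡 m) x)]
    [IsContMDiffRiemannianBundle (𝓡 m) ∞ (EuclideanSpace ℝ (Fin m))
      (fun x : Z => TangentSpace (𝓡 m) x)]
    (Ξ : Set (EuclideanSpace ℝ (Fin d))) (hΞ : IsOpen Ξ)
    (φ : EuclideanSpace ℝ (Fin d) → Z) (hφ : ContMDiffOn (𝓡 d) (𝓡 m) ∞ φ Ξ)
    [ChartedSpace (EuclideanSpace ℝ (Fin n)) (NatGrad.smoothPoints m (φ '' Ξ))]
    [IsManifold (𝓡 n) ∞ (NatGrad.smoothPoints m (φ '' Ξ))]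
    (hS : Manifold.IsSmoothEmbedding (𝓡 n) (𝓡 m) ∞
      (Subtype.val : NatGrad.smoothPoints m (φ '' Ξ) → Z)) :
    NatGrad.MeasureZero n
      {q : NatGrad.smoothPoints m (φ '' Ξ) |
        ∃ ξ ∈ Ξ, φ ξ = q ∧ ¬ NatGrad.IsProperAt m φ Ξ ξ} ∧
    ∀ L : Z → ℝ, ContMDiff (𝓡 m) 𝓘(ℝ, ℝ) ∞ L →
      ∀ Gp : EuclideanSpace ℝ (Fin d) → Matrix (Fin d) (Fin d) ℝ,
        (∀ ξ ∈ Ξ, NatGrad.IsGeneralizedInverse (NatGrad.gramMatrix (m := m) φ ξ) (Gp ξ)) →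
        NatGrad.MeasureZero n
          {q : NatGrad.smoothPoints m (φ '' Ξ) |
            ∃ ξ ∈ Ξ, φ ξ = q ∧
              NatGrad.pushforwardNatParamGradient m φ L (Gp ξ) ξ ≠
                NatGrad.naturalGradient (φ '' Ξ) L (φ ξ)} := by
  have h := NatGrad.measureZero_not_isProperAt hΞ hφ hS
  refine ⟨h, fun L hL Gp hGp e he => measure_mono_null (image_mono ?_) (h e he)⟩
  refine inter_subset_inter_left _ ?_
  rintro q ⟨ξ, hξ, hξq, hne⟩
  exact ⟨ξ, hξ, hξq, fun hp => hne <| NatGrad.pushforward_eq_naturalGradient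
    ((hφ.contMDiffAt (hΞ.mem_nhds hξ)).mdifferentiableAt (by simp)) hp
    ((hL _).mdifferentiableAt (by simp)) (hGp ξ hξ)⟩
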